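/- The signature $B=\bigcup_{k,l}B^{k,l}$ of predicative recursive function symbols ($k$ normal and $l$ safe argument places, separated by a semicolon) is defined inductively by: \begin{itemize} \item $S_0,S_1,P\in B^{0,1}$ and $C\in B^{0,3}$; for all $k,l\ge 0$, $O^{k,l}\in B^{k,l}$ and $U^{k,l}_r\in B^{k,l}$ ($1\le r\le k+l$); \item if $f\in B^{k',l'}$, $g_1,\dots,g_{k'}\in B^{k,0}$ and $h_1,\dots,h_{l'}\in B^{k,l}$, then $\mathrm{SUB}[f,\vec g,\vec h]\in B^{k,l}$; \item if $g\in B^{k,l}$ and $h_0,h_1\in B^{k+1,l+1}$, then $\mathrm{PREC}[g,h_0,h_1]\in B^{k+1,l}$. \end{itemize} Ground terms are built from the symbols in $B$ and a constant $0$. Ground terms built from $0$, $S_0$, $S_1$ only are called numeral terms. The numeral $\overline{m}$ of $m\in\mathbb{N}$ is given by $\overline{0}=0$ and $\overline{2m+i}=S_i(;\overline{m})$ for $i\in\{0,1\}$ and $2m+i\neq 0$; $|m|$ denotes the binary length of $m$ (with $|0|=0$). The Beckmann--Weiermann system $R_B'$ is the infinite rewrite system with the following rules, where $i\in\{0,1\}$,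 $\vec x,\vec a,a,a_0,a_1,b$ stand for arbitrary terms, and $\vec n$ stands for numeral terms only: \begin{align*} O^{k,l}(\vec x;\vec a)&\to 0, & U^{k,l}_r(x_1,\dots,x_k;x_{k+1},\dots,x_{k+l})&\to x_r,\\ P(;0)&\to 0, & P(;S_i(;a))&\to a,\\ C(;0,a_0,a_1)&\to a_0, & C(;S_i(;a),a_0,a_1)&\to a_i, \end{align*} \begin{align*} \mathrm{SUB}[f,\vec g,\vec h](\vec x;\vec n)&\to f(\vec g(\vec x;);\vec h(\vec x;\vec n)),\\ \mathrm{PREC}[g,h_0,h_1](0,\vec x;\vec n)&\to g(\vec x;\vec n),\\ \mathrm{PREC}[g,h_0,h_1](S_i(;b),\vec x;\vec n)&\to h_i(b,\vec x;\vec n,\mathrm{PREC}[g,h_0,h_1](b,\vec x;\vec n)). \end{align*} Let $\to$ also denote the rewrite relation of $R_B'$ on ground terms (a rule may be applied at any position of a term). \textbf{Theorem.} For every $f\in B^{p,q}$ there is a monotone polynomial $P$ such that for all $m_1,\dots,m_p,n_1,\dots,n_q\in\mathbb{N}$ the derivation length $$\max\{N \mid \exists\, t_0,\dots,t_N \text{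 ground terms with } f(\overline{m}_1,\dots,\overline{m}_p;\overline{n}_1,\dots,\overline{n}_q)=t_0\to t_1\to\cdots\to t_N\}$$ exists and is at most $P(|m_1|+\cdots+|m_p|)$. -/

import Mathlib

namespace PredRec

/-- The signature `B` of predicative recursive function symbols. `BSym k l` is `B^{k,l}`:
the symbols with `k` normal and `l` safe argument places. A digit `0` or `1` is represented by
`false` or `true`, as in `Nat.bit`. -/
inductive BSym : ℕ → ℕ → Type
  /-- the binary successors `S_i^{0,1}` -/
  | succ (i : Bool) : BSym 0 1
  /-- the zero functions `O^{k,l}` -/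
  | zeroFn (k l : ℕ) : BSym k l
  /-- the projections `U_r^{k,l}` -/
  | proj (k l : ℕ) (r : Fin (k + l)) : BSym k l
  /-- the binary predecessor `P^{0,1}` -/
  | pred : BSym 0 1
  /-- the conditional `C^{0,3}` -/
  | cond : BSym 0 3
  /-- safe composition `SUB[f, g, h]` -/
  | sub {k l k' l' : ℕ} (f : BSym k' l') (g : Fin k' → BSym k 0) (h : Fin l' → BSym k l) :
      BSym k l
  /-- predicative recursion on notation `PREC[g, h_0, h_1]` -/
  | prec {k l : ℕ} (g : BSym k l) (h : Bool → BSym (k + 1) (l + 1)) : BSym (k + 1) l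

/-- Ground terms over `B` and the constant `0`; `app f t s` is `f(t_1,…,t_k; s_1,…,s_l)`. -/
inductive Term : Type
  | zero : Term
  | app {k l : ℕ} (f : BSym k l) (t : Fin k → Term) (s : Fin l → Term) : Term

/-- The term `S_i(; t)`. -/
def Term.succ (i : Bool) (t : Term) : Term := Term.app (BSym.succ i) ![] ![t]

/-- The terms built from `0` by `S_0` and `S_1`, that is, the ground constructor terms. -/
inductive IsNumeral : Term → Prop
  | zero : IsNumeral Term.zero
  | succ (i : Bool) {t : Term} (ht : IsNumeral t) : IsNumeral (Term.succ i t)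

/-- The numeral of a natural number: the numeral of `0` is `0`, and the numeral of `2 m + i`
is `S_i` of the numeral of `m` (`Nat.bits` lists the binary digits, least significant first). -/
def numeral (m : ℕ) : Term := m.bits.foldr Term.succ Term.zero

theorem numeral_zero : numeral 0 = Term.zero := by
  simp [numeral]

theorem numeral_bit (i : Bool) (m : ℕ) (h : m = 0 → i = true) :
    numeral (Nat.bit i m) = Term.succ i (numeral m) := by
  simp [numeral, Nat.bits_append_bit m i h]

theorem isNumeral_numeral (m : ℕ) : IsNumeral (numeral m) := by
  unfold numeral
  induction m.bits with
  | nil => exact IsNumeral.zero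
  | cons i _ ih => exact IsNumeral.succ i ih

/-- `Rule l r`: the pair `l → r` is a ground instance of a rule of `R_B'`. In the rules of safe
composition and predicative recursion the safe arguments `n` have to be numerals; all other
arguments are arbitrary ground terms. -/
inductive Rule : Term → Term → Prop
  | zeroFn {k l : ℕ} (x : Fin k → Term) (a : Fin l → Term) :
      Rule (Term.app (BSym.zeroFn k l) x a) Term.zero
  | proj {k l : ℕ} (r : Fin (k + l)) (x : Fin k → Term) (a : Fin l → Term) :
      Rule (Term.app (BSym.proj k l r) x a) (Fin.append x a r)
  | pred_zero :
      Rule (Term.app BSym.pred ![] ![Term.zero]) Term.zero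
  | pred_succ (i : Bool) (a : Term) :
      Rule (Term.app BSym.pred ![] ![Term.succ i a]) a
  | cond_zero (a₀ a₁ : Term) :
      Rule (Term.app BSym.cond ![] ![Term.zero, a₀, a₁]) a₀
  | cond_succ (i : Bool) (a a₀ a₁ : Term) :
      Rule (Term.app BSym.cond ![] ![Term.succ i a, a₀, a₁]) (bif i then a₁ else a₀)
  | sub {k l k' l' : ℕ} (f : BSym k' l') (g : Fin k' → BSym k 0) (h : Fin l' → BSym k l)
      (x : Fin k → Term) (n : Fin l → Term) (hn : ∀ j, IsNumeral (n j)) :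
      Rule (Term.app (BSym.sub f g h) x n)
        (Term.app f (fun i => Term.app (g i) x ![]) (fun j => Term.app (h j) x n))
  | prec_zero {k l : ℕ} (g : BSym k l) (h : Bool → BSym (k + 1) (l + 1))
      (x : Fin k → Term) (n : Fin l → Term) (hn : ∀ j, IsNumeral (n j)) :
      Rule (Term.app (BSym.prec g h) (Fin.cons Term.zero x) n) (Term.app g x n)
  | prec_succ {k l : ℕ} (g : BSym k l) (h : Bool → BSym (k + 1) (l + 1))
      (i : Bool) (b : Term) (x : Fin k → Term) (n : Fin l → Term)
      (hn : ∀ j, IsNumeral (n j)) :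
      Rule (Term.app (BSym.prec g h) (Fin.cons (Term.succ i b) x) n)
        (Term.app (h i) (Fin.cons b x)
          (Fin.snoc n (Term.app (BSym.prec g h) (Fin.cons b x) n)))

/-- The rewrite relation of `R_B'` on ground terms: one rule is applied at one position, which
may be any position of the term. -/
inductive Step : Term → Term → Prop
  | root {u v : Term} (h : Rule u v) : Step u v
  | normal {k l : ℕ} (f : BSym k l) (t : Fin k → Term) (s : Fin l → Term) (i : Fin k)
      {u : Term} (h : Step (t i) u) :
      Step (Term.app f t s) (Term.app f (Function.update t i u) s)
  | safe {k l : ℕ} (f : BSym k l) (t : Fin k → Term) (s : Fin l → Term) (j : Fin l)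
      {u : Term} (h : Step (s j) u) :
      Step (Term.app f t s) (Term.app f t (Function.update s j u))

/-- The set of all `N` for which there is a derivation `t_0 → t_1 → ⋯ → t_N` with `t_0 = u`. -/
def derivationLengths (u : Term) : Set ℕ :=
  {N | ∃ t : ℕ → Term, t 0 = u ∧ ∀ i < N, Step (t i) (t (i + 1))}

/-- The derivation length function of `f`: the maximal length of a derivation starting with
`f(m_1,…,m_p; n_1,…,n_q)`, all arguments being numerals. The value is meaningful when the
maximum exists. -/
noncomputable def derivationLength {p q : ℕ} (f : BSym p q) (m : Fin p → ℕ) (n : Fin q → ℕ) :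
    ℕ :=
  sSup (derivationLengths
    (Term.app f (fun i => numeral (m i)) (fun j => numeral (n j))))

end PredRec

namespace PredRec

open Finset

/-! Two interpretations in ℕ work together. `Term.length` bounds the size of the value and never
increases under rewriting. `Term.weight` strictly decreases, so it bounds derivation lengths. In the
weight of `f(t; s)`, a polynomial in the lengths of the normal arguments multiplies their weights,
while safe weights are merely added and safe lengths are ignored. A recursive call in a safe
position thus adds its weight only once. Numerals weigh 0, so copying numeral safe arguments in SUB
and PREC is free, and the initial term weighs exactly `f.weightPoly` at the total normal length. -/

/-- The length of the value of `f(x; a)` exceeds the maximal length of the safe arguments `a` by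
at most `f.lengthPoly`, evaluated at the total length of the normal arguments `x`. -/
noncomputable def BSym.lengthPoly : {k l : ℕ} → BSym k l → Polynomial ℕ
  | _, _, .succ _ => 1
  | _, _, .zeroFn _ _ => 0
  | _, _, .proj _ _ _ => Polynomial.X
  | _, _, .pred => 0
  | _, _, .cond => 0
  | _, _, .sub f g h =>
      (f.lengthPoly).comp (∑ i, (g i).lengthPoly) + ∑ j, (h j).lengthPoly
  | _, _, .prec g h =>
      g.lengthPoly + Polynomial.X * ((h false).lengthPoly + (h true).lengthPoly)

/-- The contribution of the symbol `f` to the interpretation `Term.weight`, as a polynomial in the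
total length of the normal arguments. -/
noncomputable def BSym.weightPoly : {k l : ℕ} → BSym k l → Polynomial ℕ
  | _, _, .succ _ => 0
  | _, _, .zeroFn _ _ => 1
  | _, _, .proj _ _ _ => 1
  | _, _, .pred => 1
  | _, _, .cond => 1
  | _, _, .sub f g h =>
      (f.weightPoly).comp (∑ i, (g i).lengthPoly) * (1 + ∑ i, (g i).weightPoly)
        + ∑ j, (h j).weightPoly + 1
  | _, _, .prec g h =>
      1 + g.weightPoly + Polynomial.X * ((h false).weightPoly + (h true).weightPoly + 1)

/-- An upper bound for the binary length of the value of a term. -/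
noncomputable def Term.length : Term → ℕ
  | .zero => 0
  | .app f t s =>
      f.lengthPoly.eval (∑ i, (t i).length) + univ.sup fun j => (s j).length

/-- An interpretation of terms that strictly decreases along the rewrite relation. -/
noncomputable def Term.weight : Term → ℕ
  | .zero => 0
  | .app f t s =>
      f.weightPoly.eval (∑ i, (t i).length) * (1 + ∑ i, (t i).weight) + ∑ j, (s j).weight

/-! ### Monotonicity and values on numerals -/

theorem monotone_eval (P : Polynomial ℕ) : Monotone fun x : ℕ => P.eval x := by
  intro x y hxy
  simp only [Polynomial.eval_eq_sum_range]
  gcongr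

@[simp] theorem Term.length_zero : Term.zero.length = 0 := rfl

@[simp] theorem Term.weight_zero : Term.zero.weight = 0 := rfl

theorem Term.length_app {k l : ℕ} (f : BSym k l) (t : Fin k → Term) (s : Fin l → Term) :
    (Term.app f t s).length =
      f.lengthPoly.eval (∑ i, (t i).length) + univ.sup fun j => (s j).length := rfl

theorem Term.weight_app {k l : ℕ} (f : BSym k l) (t : Fin k → Term) (s : Fin l → Term) :
    (Term.app f t s).weight =
      f.weightPoly.eval (∑ i, (t i).length) * (1 + ∑ i, (t i).weight) + ∑ j, (s j).weight := rfl

@[simp] theorem Term.length_succ (i : Bool) (t : Term) : (t.succ i).length = t.length + 1 := by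
  simp [Term.succ, Term.length_app, BSym.lengthPoly, add_comm]

@[simp] theorem Term.weight_succ (i : Bool) (t : Term) : (t.succ i).weight = t.weight := by
  simp [Term.succ, Term.weight_app, BSym.weightPoly]

theorem IsNumeral.weight_eq_zero {t : Term} (h : IsNumeral t) : t.weight = 0 := by
  induction h with
  | zero => rfl
  | succ i _ ih => simpa using ih

theorem length_numeral (m : ℕ) : (numeral m).length = m.size := by
  rw [← Nat.size_eq_bits_len, numeral]
  induction m.bits with
  | nil => rfl
  | cons i l ih => simp [ih]

/-- Makes the weight strictly monotone in normal arguments. Only the successors have `weightPoly` 0,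
and they have no normal places. -/
theorem BSym.one_le_eval_weightPoly {k l : ℕ} (f : BSym k l) (hk : 0 < k) (x : ℕ) :
    1 ≤ f.weightPoly.eval x := by
  cases f <;> simp_all [BSym.weightPoly]
  omega

/-! ### Behaviour under the rules at the root -/

theorem Rule.length_le {u v : Term} (h : Rule u v) : v.length ≤ u.length := by
  cases h with
  | zeroFn x a => simp
  | @proj k l r x a =>
    simp only [Term.length_app, BSym.lengthPoly, Polynomial.eval_X]
    induction r using Fin.addCases with
    | left i =>
      rw [Fin.append_left]
      have := single_le_sum (f := fun i => (x i).length) (fun _ _ => Nat.zero_le _) (mem_univ i)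
      omega
    | right j =>
      rw [Fin.append_right]
      have := le_sup (f := fun j => (a j).length) (mem_univ j)
      omega
  | pred_zero => simp
  | pred_succ i a => simp [Term.length_app, BSym.lengthPoly]
  | cond_zero _ a₁ =>
    have := le_sup (f := fun j => (![Term.zero, v, a₁] j).length) (mem_univ 1)
    exact this.trans (Nat.le_add_left _ _)
  | cond_succ i a a₀ a₁ =>
    rw [Term.length_app]
    refine le_trans ?_ (Nat.le_add_left _ _)
    cases i
    · exact le_sup (f := fun j => (![Term.succ false a, a₀, a₁] j).length) (mem_univ 1)
    · exact le_sup (f := fun j => (![Term.succ true a, a₀, a₁] j).length) (mem_univ 2)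
  | sub f g h x n hn =>
    simp only [Term.length_app, BSym.lengthPoly, Polynomial.eval_add, Polynomial.eval_comp,
      Polynomial.eval_finsetSum, univ_eq_empty, sup_empty, bot_eq_zero, add_zero, add_assoc]
    gcongr
    refine Finset.sup_le fun j _ => ?_
    gcongr
    exact single_le_sum (f := fun j => (h j).lengthPoly.eval (∑ i, (x i).length))
      (fun _ _ => Nat.zero_le _) (mem_univ j)
  | prec_zero g h x n hn =>
    simp only [Term.length_app, BSym.lengthPoly, Polynomial.eval_add, Fin.sum_univ_succ,
      Fin.cons_zero, Fin.cons_succ, Term.length_zero, zero_add]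
    omega
  | prec_succ g h i b x n hn =>
    simp only [Term.length_app, BSym.lengthPoly, Polynomial.eval_add, Polynomial.eval_mul,
      Polynomial.eval_X, Fin.sum_univ_succ, Fin.cons_zero, Fin.cons_succ, Term.length_succ]
    set L := b.length + ∑ i, (x i).length with hL
    set s := univ.sup fun j => (n j).length with hs
    have e : b.length + 1 + ∑ i, (x i).length = L + 1 := by omega
    rw [e]
    have hg := monotone_eval g.lengthPoly (Nat.le_succ L)
    have h0 := monotone_eval (h false).lengthPoly (Nat.le_succ L)
    have h1 := monotone_eval (h true).lengthPoly (Nat.le_succ L)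
    simp only [Nat.succ_eq_add_one] at hg h0 h1
    -- The recursive call, of normal length `L`, dominates every other safe argument of `h i`.
    have key : (univ.sup fun j => (Fin.snoc (α := fun _ => Term) n
        (Term.app (BSym.prec g h) (Fin.cons b x) n) j).length) ≤
        g.lengthPoly.eval L + L * ((h false).lengthPoly.eval L + (h true).lengthPoly.eval L)
          + s := by
      refine Finset.sup_le fun j _ => ?_
      induction j using Fin.lastCases with
      | last =>
        simp [Term.length_app, BSym.lengthPoly, Fin.sum_univ_succ, ← hL, ← hs]
      | cast j =>
        rw [Fin.snoc_castSucc]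
        exact (le_sup (f := fun j => (n j).length) (mem_univ j)).trans (Nat.le_add_left _ _)
    have hi : (h i).lengthPoly.eval L ≤
        (h false).lengthPoly.eval L + (h true).lengthPoly.eval L := by
      cases i <;> omega
    calc _ ≤ ((h false).lengthPoly.eval L + (h true).lengthPoly.eval L) +
          (g.lengthPoly.eval L + L * ((h false).lengthPoly.eval L + (h true).lengthPoly.eval L)
          + s) := add_le_add hi key
      _ = g.lengthPoly.eval L +
          (L + 1) * ((h false).lengthPoly.eval L + (h true).lengthPoly.eval L) + s := by ring
      _ ≤ _ := by gcongr

theorem Rule.weight_lt {u v : Term} (h : Rule u v) : v.weight < u.weight := by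
  cases h with
  | zeroFn x a => simp [Term.weight_app, BSym.weightPoly]
  | @proj k l r x a =>
    simp only [Term.weight_app, BSym.weightPoly, Polynomial.eval_one, one_mul]
    induction r using Fin.addCases with
    | left i =>
      rw [Fin.append_left]
      have := single_le_sum (f := fun i => (x i).weight) (fun _ _ => Nat.zero_le _) (mem_univ i)
      omega
    | right j =>
      rw [Fin.append_right]
      have := single_le_sum (f := fun j => (a j).weight) (fun _ _ => Nat.zero_le _) (mem_univ j)
      omega
  | pred_zero => simp [Term.weight_app, BSym.weightPoly]
  | pred_succ i a => simp [Term.weight_app, BSym.weightPoly]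
  | cond_zero _ a₁ =>
    simp [Term.weight_app, BSym.weightPoly, Fin.sum_univ_three]
    omega
  | cond_succ i a a₀ a₁ =>
    cases i <;> simp [Term.weight_app, BSym.weightPoly, Fin.sum_univ_three] <;> omega
  | sub f g h x n hn =>
    simp only [Term.weight_app, Term.length_app, BSym.weightPoly, Polynomial.eval_add,
      Polynomial.eval_mul, Polynomial.eval_one, Polynomial.eval_comp,
      Polynomial.eval_finsetSum, univ_eq_empty, sup_empty, sum_empty, bot_eq_zero, add_zero,
      (hn _).weight_eq_zero, sum_const_zero, ← sum_mul]
    set L := ∑ i, (x i).length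
    set W := ∑ i, (x i).weight
    set F := f.weightPoly.eval (∑ i, (g i).lengthPoly.eval L)
    set G := ∑ i, (g i).weightPoly.eval L
    set H := ∑ j, (h j).weightPoly.eval L
    -- The added `F * W` lets `1 + W` factor out; the final `+ 1` of `weightPoly` then gives
    -- strictness.
    calc F * (1 + G * (1 + W)) + H * (1 + W)
        ≤ F * (1 + G * (1 + W)) + H * (1 + W) + F * W := Nat.le_add_right _ _
      _ = (F * (1 + G) + H) * (1 + W) := by ring
      _ < (F * (1 + G) + H + 1) * (1 + W) :=
          Nat.mul_lt_mul_of_pos_right (Nat.lt_succ_self _) (by omega)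
  | prec_zero g h x n hn =>
    simp only [Term.weight_app, BSym.weightPoly, Polynomial.eval_add, Polynomial.eval_one,
      Fin.sum_univ_succ, Fin.cons_zero, Fin.cons_succ, Term.length_zero, Term.weight_zero,
      zero_add, (hn _).weight_eq_zero, sum_const_zero, add_zero]
    exact Nat.mul_lt_mul_of_pos_right (by omega) (by omega)
  | @prec_succ k l g h i b x n hn =>
    simp only [Term.weight_app, BSym.weightPoly, Polynomial.eval_add, Polynomial.eval_mul,
      Polynomial.eval_one, Polynomial.eval_X, Fin.sum_univ_castSucc (n := l),
      Fin.sum_univ_succ (n := k), Fin.cons_zero, Fin.cons_succ, Fin.snoc_castSucc, Fin.snoc_last,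
      Term.length_succ, Term.weight_succ, (hn _).weight_eq_zero, sum_const_zero, zero_add, add_zero]
    set L := b.length + ∑ i, (x i).length with hL
    set W := b.weight + ∑ i, (x i).weight
    have e : b.length + 1 + ∑ i, (x i).length = L + 1 := by omega
    rw [e, ← add_mul]
    have hg := monotone_eval g.weightPoly (Nat.le_succ L)
    have h0 := monotone_eval (h false).weightPoly (Nat.le_succ L)
    have h1 := monotone_eval (h true).weightPoly (Nat.le_succ L)
    simp only [Nat.succ_eq_add_one] at hg h0 h1
    refine Nat.mul_lt_mul_of_pos_right ?_ (by omega)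
    have hi : (h i).weightPoly.eval L ≤
        (h false).weightPoly.eval L + (h true).weightPoly.eval L := by
      cases i <;> omega
    -- Consuming one digit releases one summand of the factor `X`; its `+ 1` pays for the step.
    calc _ < ((h false).weightPoly.eval L + (h true).weightPoly.eval L + 1) + (1 +
          g.weightPoly.eval L +
          L * ((h false).weightPoly.eval L + (h true).weightPoly.eval L + 1)) := by omega
      _ = 1 + g.weightPoly.eval L +
          (L + 1) * ((h false).weightPoly.eval L + (h true).weightPoly.eval L + 1) := by ring
      _ ≤ _ := by gcongr

/-! ### Rewriting inside a context -/

theorem apply_update_le {k : ℕ} (φ : Term → ℕ) (t : Fin k → Term) (i : Fin k) {u : Term}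
    (h : φ u ≤ φ (t i)) (j : Fin k) : φ (Function.update t i u j) ≤ φ (t j) := by
  rcases eq_or_ne j i with rfl | hj
  · simpa using h
  · simp [hj]

theorem sum_apply_update_lt {k : ℕ} (φ : Term → ℕ) (t : Fin k → Term) (i : Fin k) {u : Term}
    (h : φ u < φ (t i)) : ∑ j, φ (Function.update t i u j) < ∑ j, φ (t j) :=
  sum_lt_sum (fun j _ => apply_update_le φ t i h.le j) ⟨i, mem_univ i, by simpa using h⟩

theorem Step.length_le {u v : Term} (h : Step u v) : v.length ≤ u.length := by
  induction h with
  | root h => exact h.length_le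
  | normal f t s i _ ih =>
    simp only [Term.length_app]
    exact Nat.add_le_add_right (monotone_eval _
      (sum_le_sum fun j _ => apply_update_le Term.length t i ih j)) _
  | safe f t s j _ ih =>
    simp only [Term.length_app]
    exact Nat.add_le_add_left
      (Finset.sup_mono_fun fun i _ => apply_update_le Term.length s j ih i) _

theorem Step.weight_lt {u v : Term} (h : Step u v) : v.weight < u.weight := by
  induction h with
  | root h => exact h.weight_lt
  | normal f t s i h ih =>
    simp only [Term.weight_app]
    -- The polynomial factor reads lengths, so `length_le` is needed to keep it from growing.
    refine Nat.add_lt_add_right (Nat.mul_lt_mul_of_le_of_lt (monotone_eval _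
      (sum_le_sum fun j _ => apply_update_le Term.length t i h.length_le j))
      (Nat.add_lt_add_left (sum_apply_update_lt Term.weight t i ih) 1) ?_) _
    exact f.one_le_eval_weightPoly i.pos _
  | safe f t s j _ ih =>
    simp only [Term.weight_app]
    exact Nat.add_lt_add_left (sum_apply_update_lt Term.weight s j ih) _

/-! ### Bounding derivations -/

theorem le_weight_of_mem_derivationLengths {u : Term} {N : ℕ} (h : N ∈ derivationLengths u) :
    N ≤ u.weight := by
  obtain ⟨t, rfl, ht⟩ := h
  have key : ∀ i ≤ N, (t i).weight + i ≤ (t 0).weight := by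
    intro i
    induction i with
    | zero => simp
    | succ i ih =>
      intro hi
      have h₁ := ih (by omega)
      have h₂ := (ht i hi).weight_lt
      omega
  have := key N le_rfl
  omega

theorem weight_app_numeral {p q : ℕ} (f : BSym p q) (m : Fin p → ℕ) (n : Fin q → ℕ) :
    (Term.app f (fun i => numeral (m i)) (fun j => numeral (n j))).weight =
      f.weightPoly.eval (∑ i, Nat.size (m i)) := by
  simp [Term.weight_app, length_numeral, (isNumeral_numeral _).weight_eq_zero]

theorem isGreatest_sSup_derivationLengths (u : Term) :
    IsGreatest (derivationLengths u) (sSup (derivationLengths u)) := by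
  have hb : BddAbove (derivationLengths u) :=
    ⟨u.weight, fun _ => le_weight_of_mem_derivationLengths⟩
  have hne : (derivationLengths u).Nonempty := ⟨0, fun _ => u, rfl, by simp⟩
  exact ⟨Nat.sSup_mem hne hb, fun _ h => le_csSup hb h⟩

end PredRec

theorem theoremt {p q : ℕ} (f : PredRec.BSym p q) :
    ∃ P : Polynomial ℕ, Monotone (fun x : ℕ => P.eval x) ∧
      ∀ (m : Fin p → ℕ) (n : Fin q → ℕ),
        IsGreatest
          (PredRec.derivationLengths
            (PredRec.Term.app f (fun i => PredRec.numeral (m i))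
              (fun j => PredRec.numeral (n j))))
          (PredRec.derivationLength f m n) ∧
        PredRec.derivationLength f m n ≤ P.eval (∑ i, Nat.size (m i)) := by
  refine ⟨f.weightPoly, PredRec.monotone_eval _, fun m n => ?_⟩
  have h := PredRec.isGreatest_sSup_derivationLengths (PredRec.Term.app f
    (fun i => PredRec.numeral (m i)) (fun j => PredRec.numeral (n j)))
  exact ⟨h, (PredRec.le_weight_of_mem_derivationLengths h.1).trans_eq
    (PredRec.weight_app_numeral f m n)⟩
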